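/- Let $\mathcal H\neq\{0\}$ be a complex Hilbert space (of finite or infinite dimension) and let $A$ be a bounded linear operator on $\mathcal H$, with $|A|=(A^*A)^{1/2}$. A bounded operator $T$ is called trace class if $\sum_i\langle |T|e_i,e_i\rangle<\infty$ for orthonormal bases $(e_i)$ of $\mathcal H$, and then $\operatorname{tr}(T)=\sum_i\langle Te_i,e_i\rangle$. Let $\mathcal S(\mathcal H)$ be the set of density operators, i.e. of the positive trace class operators $P$ with $\operatorname{tr}(P)=1$. Then, for every $P\in\mathcal S(\mathcal H)$, the operators $|A|^2P$ and $AP$ are trace class and $\operatorname{tr}(|A|^2P)-|\operatorname{tr}(AP)|^2$ is a nonnegative real number, and $$\sup\Big\{\big[\operatorname{tr}(|A|^2P)-|\operatorname{tr}(AP)|^2\big]^{1/2} : P\in\mathcal S(\mathcal H)\Big\}=\operatorname{dist}(A,\mathbb C\,\mathrm{Id})=\inf_{\lambda\in\mathbb C}\|A-\lambda\,\mathrm{Id}\|.$$ -/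

import Mathlib

open scoped InnerProductSpace

universe u

namespace OperatorVariance

/-- A bounded operator `T` is trace class if `∑ᵢ ⟨bᵢ, |T| bᵢ⟩` converges for every
orthonormal (Hilbert) basis `b`, where `|T| = (T⋆T)^{1/2}`. -/
def IsTraceClass {H : Type u} [NormedAddCommGroup H] [InnerProductSpace ℂ H] [CompleteSpace H]
    (T : H →L[ℂ] H) : Prop :=
  ∀ (ι : Type u) (b : HilbertBasis ι ℂ H), Summable fun i => ⟪b i, CFC.abs T (b i)⟫_ℂ

/-- An orthonormal basis of `H`, fixed once and for all: its index set. -/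
noncomputable def basisIndex (H : Type u) [NormedAddCommGroup H] [InnerProductSpace ℂ H]
    [CompleteSpace H] : Set H :=
  (exists_hilbertBasis ℂ H).choose

/-- An orthonormal basis of `H`, fixed once and for all. -/
noncomputable def basis (H : Type u) [NormedAddCommGroup H] [InnerProductSpace ℂ H]
    [CompleteSpace H] : HilbertBasis (basisIndex H) ℂ H :=
  (exists_hilbertBasis ℂ H).choose_spec.choose

/-- The trace `∑ᵢ ⟨bᵢ, T bᵢ⟩`. It is meaningful for trace class `T`, and for those it does not
depend on the orthonormal basis used. -/
noncomputable def trace {H : Type u} [NormedAddCommGroup H] [InnerProductSpace ℂ H]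
    [CompleteSpace H] (T : H →L[ℂ] H) : ℂ :=
  ∑' i, ⟪basis H i, T (basis H i)⟫_ℂ

/-- The density operators (states) on `H`: positive trace class operators of trace one. -/
def densityOperators (H : Type u) [NormedAddCommGroup H] [InnerProductSpace ℂ H]
    [CompleteSpace H] : Set (H →L[ℂ] H) :=
  {P | P.IsPositive ∧ IsTraceClass P ∧ trace P = 1}

/-- The variance `tr(|A|² P) - |tr(A P)|²` of `A` with respect to `P`. -/
noncomputable def variance {H : Type u} [NormedAddCommGroup H] [InnerProductSpace ℂ H]
    [CompleteSpace H] (P A : H →L[ℂ] H) : ℂ :=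
  trace (CFC.abs A ^ 2 * P) - (‖trace (A * P)‖ : ℂ) ^ 2

end OperatorVariance

namespace OperatorVariance

open ContinuousLinearMap InnerProductSpace

variable {H : Type u} [NormedAddCommGroup H] [InnerProductSpace ℂ H]

/-! Adding a scalar to `A` does not change the variance, and a second moment is at most the squared
norm, so each variance is at most `‖A - c‖²` for every `c`. For sharpness, let `B = A - c` with `c`
a best scalar approximation. The means of the states whose second moment is within `ε` of `‖B‖²`
form a convex set. If its closure missed `0`, Hahn–Banach would give a direction in which a small
scalar shift strictly lowers `‖B‖` (`zero_mem_closure_nearMaximalMeans`). Hence some state has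
second moment near `‖B‖²` and mean near `0`. Traces against a state `P` are computed from the
vectors `√P eᵢ`. -/

lemma inner_apply_eq_ofReal_re {P : H →L[ℂ] H} (hP : P.IsPositive) (x : H) :
    ⟪x, P x⟫_ℂ = ((⟪x, P x⟫_ℂ).re : ℂ) := by
  have h := RCLike.nonneg_iff.1 (hP.inner_nonneg_right x)
  exact Complex.ext rfl (by simpa using h.2)

/-- Parseval's identity. -/
lemma hasSum_norm_inner_sq {ι : Type*} (e : HilbertBasis ι ℂ H) (x : H) :
    HasSum (fun i => ‖⟪e i, x⟫_ℂ‖ ^ 2) (‖x‖ ^ 2) := by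
  have h := Complex.hasSum_re (e.hasSum_inner_mul_inner x x)
  have h2 : (⟪x, x⟫_ℂ).re = ‖x‖ ^ 2 := inner_self_eq_norm_sq (𝕜 := ℂ) x
  rw [h2] at h
  refine h.congr_fun fun i => ?_
  rw [← inner_conj_symm x, mul_comm, Complex.mul_conj, Complex.normSq_eq_norm_sq,
    Complex.ofReal_re]

lemma summable_norm_inner_sq {ι κ : Type*} (e : HilbertBasis ι ℂ H) {v : κ → H}
    (hv : Summable fun j => ‖v j‖ ^ 2) :
    Summable fun p : κ × ι => ‖⟪e p.2, v p.1⟫_ℂ‖ ^ 2 := by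
  refine (summable_prod_of_nonneg fun p => by positivity).2
    ⟨fun j => (hasSum_norm_inner_sq e (v j)).summable, ?_⟩
  simpa only [(hasSum_norm_inner_sq e (v _)).tsum_eq] using hv

/-- Parseval and `ab ≤ a² + b²` give absolute convergence, which licenses exchanging the two sums.
-/
lemma summable_inner_mul_inner_prod {ι κ : Type*} (e : HilbertBasis ι ℂ H) {v w : κ → H}
    (hv : Summable fun j => ‖v j‖ ^ 2) (hw : Summable fun j => ‖w j‖ ^ 2) :
    Summable fun p : κ × ι => ⟪v p.1, e p.2⟫_ℂ * ⟪e p.2, w p.1⟫_ℂ := by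
  refine Summable.of_norm_bounded
    ((summable_norm_inner_sq e hv).add (summable_norm_inner_sq e hw)) fun p => ?_
  rw [norm_mul, norm_inner_symm]
  nlinarith [sq_nonneg (‖⟪e p.2, v p.1⟫_ℂ‖ - ‖⟪e p.2, w p.1⟫_ℂ‖),
    sq_nonneg ‖⟪e p.2, v p.1⟫_ℂ‖, sq_nonneg ‖⟪e p.2, w p.1⟫_ℂ‖]

lemma hasSum_inner_rankOne {ι : Type*} (e : HilbertBasis ι ℂ H) (x : H) (B : H →L[ℂ] H) :
    HasSum (fun i => ⟪e i, (B * rankOne ℂ x x) (e i)⟫_ℂ) ⟪x, B x⟫_ℂ := by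
  refine (e.hasSum_inner_mul_inner x (B x)).congr_fun fun i => ?_
  rw [mul_def, comp_apply, rankOne_apply, map_smul, inner_smul_right]

lemma hasSum_inner_mul_add_smul {ι : Type*} {e : ι → H} {P Q B : H →L[ℂ] H} {p q : ℂ}
    (hP : HasSum (fun i => ⟪e i, (B * P) (e i)⟫_ℂ) p)
    (hQ : HasSum (fun i => ⟪e i, (B * Q) (e i)⟫_ℂ) q) (a b : ℝ) :
    HasSum (fun i => ⟪e i, (B * (a • P + b • Q)) (e i)⟫_ℂ) (a * p + b * q) := by
  refine ((hP.mul_left (a : ℂ)).add (hQ.mul_left (b : ℂ))).congr_fun fun i => ?_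
  have h : (B * (a • P + b • Q)) (e i) = (a : ℂ) • (B * P) (e i) + (b : ℂ) • (B * Q) (e i) := by
    rw [mul_add, mul_smul_comm, mul_smul_comm, _root_.add_apply, _root_.smul_apply,
      _root_.smul_apply, Complex.coe_smul, Complex.coe_smul]
  rw [h, inner_add_right, inner_smul_right, inner_smul_right]

lemma norm_sub_smul_one_apply_sq (B : H →L[ℂ] H) {x : H} (hx : ‖x‖ = 1) (c : ℂ) :
    ‖(B - c • (1 : H →L[ℂ] H)) x‖ ^ 2 =
      ‖B x‖ ^ 2 - 2 * (c * starRingEnd ℂ ⟪x, B x⟫_ℂ).re + ‖c‖ ^ 2 := by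
  have h1 : (B - c • (1 : H →L[ℂ] H)) x = B x - c • x := by simp
  rw [h1, norm_sub_sq (𝕜 := ℂ), inner_smul_right, ← inner_conj_symm, norm_smul, hx, mul_one]
  rfl

lemma infDist_span_one_le (A : H →L[ℂ] H) (c : ℂ) :
    Metric.infDist A (Submodule.span ℂ {(1 : H →L[ℂ] H)} : Set (H →L[ℂ] H)) ≤
      ‖A - c • (1 : H →L[ℂ] H)‖ := by
  rw [← dist_eq_norm]
  exact Metric.infDist_le_dist_of_mem
    (Submodule.smul_mem _ c (Submodule.mem_span_singleton_self 1))

lemma le_infDist_span_one (A : H →L[ℂ] H) {r : ℝ}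
    (h : ∀ c : ℂ, r ≤ ‖A - c • (1 : H →L[ℂ] H)‖) :
    r ≤ Metric.infDist A (Submodule.span ℂ {(1 : H →L[ℂ] H)} : Set (H →L[ℂ] H)) := by
  refine (Metric.le_infDist ⟨0, Submodule.zero_mem _⟩).2 fun T hT => ?_
  obtain ⟨c, rfl⟩ := Submodule.mem_span_singleton.1 hT
  rw [dist_eq_norm]
  exact h c

/-! ### Trace class products and traces against a state -/

variable [CompleteSpace H]

/-- Operator monotonicity of the square root gives `|B P| ≤ ‖B‖ P` for positive `P`. -/
lemma abs_mul_le_norm_smul {P : H →L[ℂ] H} (hP : 0 ≤ P) (B : H →L[ℂ] H) :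
    CFC.abs (B * P) ≤ ‖B‖ • P := by
  have hP' : 0 ≤ ‖B‖ • P := smul_nonneg (norm_nonneg B) hP
  rw [CFC.abs, ← CFC.sqrt_mul_self (‖B‖ • P) hP']
  refine CFC.sqrt_le_sqrt _ _ ?_
  have h := star_left_conjugate_le_conjugate
    (CStarAlgebra.star_mul_le_algebraMap_norm_sq (a := B)) P
  have e : star P * (algebraMap ℝ (H →L[ℂ] H)) (‖B‖ ^ 2) * P = (‖B‖ • P) * (‖B‖ • P) := by
    rw [hP.star_eq, Algebra.algebraMap_eq_smul_one]
    simp [smul_smul, sq]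
  rw [e] at h
  simpa [star_mul, mul_assoc] using h

lemma isTraceClass_iff_of_isPositive {P : H →L[ℂ] H} (hP : P.IsPositive) :
    IsTraceClass P ↔
      ∀ (ι : Type u) (b : HilbertBasis ι ℂ H), Summable fun i => ⟪b i, P (b i)⟫_ℂ := by
  rw [IsTraceClass, CFC.abs_of_nonneg P ((nonneg_iff_isPositive P).2 hP)]

/-- The product of a bounded operator with a positive trace class operator is trace class. -/
lemma IsTraceClass.mul_left_of_isPositive {P : H →L[ℂ] H} (hP : P.IsPositive)
    (hT : IsTraceClass P) (B : H →L[ℂ] H) : IsTraceClass (B * P) := by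
  rw [isTraceClass_iff_of_isPositive hP] at hT
  intro ι b
  have hle := abs_mul_le_norm_smul ((nonneg_iff_isPositive P).2 hP) B
  have habs : (CFC.abs (B * P)).IsPositive := (nonneg_iff_isPositive _).1 (CFC.abs_nonneg _)
  have hs : Summable fun i => ‖B‖ * (⟪b i, P (b i)⟫_ℂ).re :=
    (Complex.hasSum_re (hT ι b).hasSum).summable.mul_left _
  have hr : Summable fun i => (⟪b i, CFC.abs (B * P) (b i)⟫_ℂ).re := by
    refine Summable.of_nonneg_of_le (fun i => habs.re_inner_nonneg_right _) (fun i => ?_) hs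
    have h := ((le_def _ _).1 hle).re_inner_nonneg_right (b i)
    have h2 : ⟪b i, (‖B‖ • P) (b i)⟫_ℂ = (‖B‖ : ℂ) * ⟪b i, P (b i)⟫_ℂ := by
      rw [_root_.smul_apply, ← Complex.coe_smul, inner_smul_right]
    rw [_root_.sub_apply, inner_sub_right, h2] at h
    simpa using h
  refine (Complex.hasSum_ofReal.2 hr.hasSum).summable.congr fun i => ?_
  exact (inner_apply_eq_ofReal_re habs _).symm

/-- The cyclicity `tr (B S S) = tr (S B S)` for a self-adjoint Hilbert–Schmidt operator `S`. -/
lemma exists_hasSum_inner_of_isSelfAdjoint {ι : Type*} (e : HilbertBasis ι ℂ H) {S : H →L[ℂ] H}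
    (hS : IsSelfAdjoint S) (hsum : Summable fun i => ‖S (e i)‖ ^ 2) (B : H →L[ℂ] H) :
    ∃ t : ℂ, HasSum (fun i => ⟪e i, (B * (S * S)) (e i)⟫_ℂ) t ∧
      HasSum (fun i => ⟪S (e i), B (S (e i))⟫_ℂ) t := by
  have hsym : ∀ x y, ⟪S x, y⟫_ℂ = ⟪x, S y⟫_ℂ := hS.isSymmetric
  have hB : Summable fun i => ‖B (S (e i))‖ ^ 2 := by
    refine Summable.of_nonneg_of_le (fun _ => by positivity) (fun i => ?_)
      (hsum.mul_left (‖B‖ ^ 2))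
    rw [← mul_pow]
    exact pow_le_pow_left₀ (norm_nonneg _) (B.le_opNorm _) 2
  have hs : HasSum (fun p : ι × ι => ⟪S (e p.1), e p.2⟫_ℂ * ⟪e p.2, B (S (e p.1))⟫_ℂ) _ :=
    (summable_inner_mul_inner_prod e hsum hB).hasSum
  refine ⟨_, ?_, hs.prod_fiberwise fun j => e.hasSum_inner_mul_inner (S (e j)) (B (S (e j)))⟩
  have hs' : HasSum
      (fun p : ι × ι => ⟪S (e p.2), e p.1⟫_ℂ * ⟪e p.1, B (S (e p.2))⟫_ℂ) _ :=
    (Equiv.prodComm ι ι).hasSum_iff.2 hs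
  refine hs'.prod_fiberwise fun i => ?_
  -- Parseval in the other index: for fixed `i`, the terms of the same double family sum to a
  -- diagonal entry of `B S S`.
  have h := e.hasSum_inner_mul_inner (adjoint (B ∘L S) (e i)) (S (e i))
  rw [adjoint_inner_left] at h
  refine h.congr_fun fun j => ?_
  rw [adjoint_inner_left, hsym, mul_comm, comp_apply]

/-- A density operator is represented by a square-summable family of vectors of total mass one. -/
lemma exists_vectors_of_mem_densityOperators {P : H →L[ℂ] H} (hP : P ∈ densityOperators H) :
    ∃ v : basisIndex H → H, HasSum (fun i => ‖v i‖ ^ 2) 1 ∧ ∀ B : H →L[ℂ] H,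
      HasSum (fun i => ⟪basis H i, (B * P) (basis H i)⟫_ℂ) (trace (B * P)) ∧
      HasSum (fun i => ⟪v i, B (v i)⟫_ℂ) (trace (B * P)) := by
  obtain ⟨hpos, htc, htr⟩ := hP
  have h0 : 0 ≤ P := (nonneg_iff_isPositive P).2 hpos
  set S := CFC.sqrt P with hSdef
  have hSS : S * S = P := CFC.sqrt_mul_sqrt_self P h0
  have hS : IsSelfAdjoint S := (CFC.sqrt_nonneg P).isSelfAdjoint
  have hsym : ∀ x y, ⟪S x, y⟫_ℂ = ⟪x, S y⟫_ℂ := hS.isSymmetric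
  have hn : ∀ x, (⟪x, P x⟫_ℂ).re = ‖S x‖ ^ 2 := fun x => by
    rw [← hSS, mul_def, comp_apply, ← hsym]
    exact inner_self_eq_norm_sq (𝕜 := ℂ) _
  have hsum := ((isTraceClass_iff_of_isPositive hpos).1 htc _ (basis H)).hasSum
  rw [show ∑' i, ⟪basis H i, P (basis H i)⟫_ℂ = 1 from htr] at hsum
  have h1 : HasSum (fun i => ‖S (basis H i)‖ ^ 2) 1 := by
    simpa only [hn, Complex.one_re] using Complex.hasSum_re hsum
  refine ⟨fun i => S (basis H i), h1, fun B => ?_⟩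
  obtain ⟨t, ht, ht'⟩ := exists_hasSum_inner_of_isSelfAdjoint (basis H) hS h1.summable B
  rw [hSS] at ht
  have : trace (B * P) = t := ht.tsum_eq
  rw [this]
  exact ⟨ht, ht'⟩

/-! ### Variance, its translation invariance and the upper bound -/

lemma inner_star_mul_self_apply (A : H →L[ℂ] H) (x : H) :
    ⟪x, (star A * A) x⟫_ℂ = ((‖A x‖ ^ 2 : ℝ) : ℂ) := by
  rw [star_eq_adjoint, mul_def, comp_apply, adjoint_inner_right, inner_self_eq_norm_sq_to_K]
  norm_cast

/-- If `v` represents the state `B ↦ tr (B P)`, then `tr (A⋆ A P)` is the mean square norm of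
`A v`. -/
lemma hasSum_norm_apply_sq {ι : Type*} {v : ι → H} {A : H →L[ℂ] H} {q : ℂ}
    (h : HasSum (fun i => ⟪v i, (star A * A) (v i)⟫_ℂ) q) :
    HasSum (fun i => ‖A (v i)‖ ^ 2) q.re ∧ q.im = 0 := by
  simp only [inner_star_mul_self_apply] at h
  refine ⟨by simpa only [Complex.ofReal_re] using Complex.hasSum_re h, ?_⟩
  have him := Complex.hasSum_im h
  simp only [Complex.ofReal_im] at him
  exact him.unique hasSum_zero

lemma variance_eq (P A : H →L[ℂ] H) :
    variance P A = trace (star A * A * P) - ((‖trace (A * P)‖ ^ 2 : ℝ) : ℂ) := by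
  rw [variance, CFC.abs_sq, Complex.ofReal_pow]

lemma variance_re (P A : H →L[ℂ] H) :
    (variance P A).re = (trace (star A * A * P)).re - ‖trace (A * P)‖ ^ 2 := by
  rw [variance_eq, Complex.sub_re, Complex.ofReal_re]

lemma variance_im {P : H →L[ℂ] H} (hP : P ∈ densityOperators H) (A : H →L[ℂ] H) :
    (variance P A).im = 0 := by
  obtain ⟨v, -, hB⟩ := exists_vectors_of_mem_densityOperators hP
  rw [variance_eq, Complex.sub_im, (hasSum_norm_apply_sq (hB (star A * A)).2).2,
    Complex.ofReal_im, sub_zero]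

lemma re_trace_star_mul_self_nonneg {P : H →L[ℂ] H} (hP : P ∈ densityOperators H)
    (A : H →L[ℂ] H) : 0 ≤ (trace (star A * A * P)).re := by
  obtain ⟨v, -, hB⟩ := exists_vectors_of_mem_densityOperators hP
  exact (hasSum_norm_apply_sq (hB (star A * A)).2).1.nonneg fun i => by positivity

lemma re_trace_star_mul_self_le {P : H →L[ℂ] H} (hP : P ∈ densityOperators H)
    (A : H →L[ℂ] H) : (trace (star A * A * P)).re ≤ ‖A‖ ^ 2 := by
  obtain ⟨v, hv, hB⟩ := exists_vectors_of_mem_densityOperators hP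
  refine (hasSum_le (fun i => ?_) (hasSum_norm_apply_sq (hB (star A * A)).2).1
    (hv.mul_left (‖A‖ ^ 2))).trans_eq (mul_one _)
  rw [← mul_pow]
  exact pow_le_pow_left₀ (norm_nonneg _) (A.le_opNorm _) 2

lemma trace_sub_smul_one_mul {P : H →L[ℂ] H} (hP : P ∈ densityOperators H) (A : H →L[ℂ] H)
    (c : ℂ) : trace ((A - c • 1) * P) = trace (A * P) - c := by
  obtain ⟨v, hv, hB⟩ := exists_vectors_of_mem_densityOperators hP
  have h1 : HasSum (fun i => ⟪v i, v i⟫_ℂ) 1 := by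
    simpa [inner_self_eq_norm_sq_to_K] using Complex.hasSum_ofReal.2 hv
  refine (hB (A - c • 1)).2.unique ?_
  have h := (hB A).2.sub (h1.mul_left c)
  rw [mul_one] at h
  refine h.congr_fun fun i => ?_
  simp

lemma re_trace_star_mul_self_sub_smul_one {P : H →L[ℂ] H} (hP : P ∈ densityOperators H)
    (A : H →L[ℂ] H) (c : ℂ) :
    (trace (star (A - c • 1) * (A - c • 1) * P)).re =
      (trace (star A * A * P)).re - 2 * (c * starRingEnd ℂ (trace (A * P))).re + ‖c‖ ^ 2 := by
  obtain ⟨v, hv, hB⟩ := exists_vectors_of_mem_densityOperators hP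
  refine (hasSum_norm_apply_sq (hB (star (A - c • 1) * (A - c • 1))).2).1.unique ?_
  have hcross : HasSum (fun i => (c * starRingEnd ℂ ⟪v i, A (v i)⟫_ℂ).re)
      (c * starRingEnd ℂ (trace (A * P))).re :=
    Complex.hasSum_re ((Complex.hasSum_conj'.2 (hB A).2).mul_left c)
  have key := ((hasSum_norm_apply_sq (hB (star A * A)).2).1.sub (hcross.mul_left 2)).add
    (hv.mul_left (‖c‖ ^ 2))
  rw [mul_one] at key
  refine key.congr_fun fun i => ?_
  have h1 : (A - c • (1 : H →L[ℂ] H)) (v i) = A (v i) - c • v i := by simp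
  rw [h1, norm_sub_sq (𝕜 := ℂ), inner_smul_right, ← inner_conj_symm, norm_smul, mul_pow]
  rfl

/-- Variance is invariant under translation by scalars. -/
lemma variance_re_sub_smul_one {P : H →L[ℂ] H} (hP : P ∈ densityOperators H) (A : H →L[ℂ] H)
    (c : ℂ) : (variance P (A - c • 1)).re = (variance P A).re := by
  rw [variance_re, variance_re, re_trace_star_mul_self_sub_smul_one hP,
    trace_sub_smul_one_mul hP, ← Complex.normSq_eq_norm_sq, ← Complex.normSq_eq_norm_sq,
    ← Complex.normSq_eq_norm_sq, Complex.normSq_sub]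
  have : (trace (A * P) * starRingEnd ℂ c).re = (c * starRingEnd ℂ (trace (A * P))).re := by
    simp only [Complex.mul_re, Complex.conj_re, Complex.conj_im]; ring
  rw [this]; ring

open scoped ComplexOrder in
lemma variance_nonneg {P : H →L[ℂ] H} (hP : P ∈ densityOperators H) (A : H →L[ℂ] H) :
    0 ≤ variance P A := by
  refine Complex.nonneg_iff.2 ⟨?_, (variance_im hP A).symm⟩
  -- Centring at the mean leaves only a second moment.
  rw [← variance_re_sub_smul_one hP A (trace (A * P)), variance_re, trace_sub_smul_one_mul hP]
  rw [sub_self, norm_zero, sq, mul_zero, sub_zero]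
  exact re_trace_star_mul_self_nonneg hP _

lemma variance_re_le_norm_sub_sq {P : H →L[ℂ] H} (hP : P ∈ densityOperators H) (A : H →L[ℂ] H)
    (c : ℂ) : (variance P A).re ≤ ‖A - c • (1 : H →L[ℂ] H)‖ ^ 2 := by
  rw [← variance_re_sub_smul_one hP A c, variance_re]
  have := re_trace_star_mul_self_le hP (A - c • 1)
  nlinarith [sq_nonneg ‖trace ((A - c • 1) * P)‖]

/-! ### Pure states and mixtures -/

lemma trace_mul_rankOne (x : H) (B : H →L[ℂ] H) :
    trace (B * rankOne ℂ x x) = ⟪x, B x⟫_ℂ :=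
  (hasSum_inner_rankOne (basis H) x B).tsum_eq

/-- The pure state given by a unit vector. -/
lemma rankOne_mem_densityOperators {x : H} (hx : ‖x‖ = 1) :
    rankOne ℂ x x ∈ densityOperators H := by
  have hpos : (rankOne ℂ x x).IsPositive := isPositive_rankOne_self x
  refine ⟨hpos, (isTraceClass_iff_of_isPositive hpos).2 fun ι b => ?_, ?_⟩
  · simpa only [one_mul] using (hasSum_inner_rankOne b x 1).summable
  · have h := trace_mul_rankOne x 1
    rw [one_mul] at h
    rw [h, one_apply_eq_self, inner_self_eq_norm_sq_to_K, hx]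
    simp

lemma trace_mul_add_smul {P Q : H →L[ℂ] H} (hP : P ∈ densityOperators H)
    (hQ : Q ∈ densityOperators H) (B : H →L[ℂ] H) (a b : ℝ) :
    trace (B * (a • P + b • Q)) = a * trace (B * P) + b * trace (B * Q) := by
  obtain ⟨_, -, hp⟩ := exists_vectors_of_mem_densityOperators hP
  obtain ⟨_, -, hq⟩ := exists_vectors_of_mem_densityOperators hQ
  exact (hasSum_inner_mul_add_smul (hp B).1 (hq B).1 a b).tsum_eq

lemma convex_densityOperators : Convex ℝ (densityOperators H) := by
  intro P hP Q hQ a b ha hb hab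
  have hpos : (a • P + b • Q).IsPositive := by
    rw [← nonneg_iff_isPositive]
    exact add_nonneg (smul_nonneg ha ((nonneg_iff_isPositive P).2 hP.1))
      (smul_nonneg hb ((nonneg_iff_isPositive Q).2 hQ.1))
  refine ⟨hpos, (isTraceClass_iff_of_isPositive hpos).2 fun ι e => ?_, ?_⟩
  · have hp := ((isTraceClass_iff_of_isPositive hP.1).1 hP.2.1 ι e).hasSum
    have hq := ((isTraceClass_iff_of_isPositive hQ.1).1 hQ.2.1 ι e).hasSum
    rw [← one_mul P] at hp
    rw [← one_mul Q] at hq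
    simpa only [one_mul] using (hasSum_inner_mul_add_smul hp hq a b).summable
  · have h := trace_mul_add_smul hP hQ 1 a b
    rw [one_mul, one_mul, one_mul, hP.2.2, hQ.2.2] at h
    rw [h, mul_one, mul_one]
    exact_mod_cast hab

/-- The means `tr (B P)` over the states `P` that nearly attain the norm of `B`. -/
def nearMaximalMeans (B : H →L[ℂ] H) (ε : ℝ) : Set ℂ :=
  {z | ∃ P ∈ densityOperators H, ‖B‖ ^ 2 - ε ≤ (trace (star B * B * P)).re ∧ trace (B * P) = z}

/-- Mean and second moment are both affine in the state; allowing mixed states makes convexity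
immediate. -/
lemma convex_nearMaximalMeans (B : H →L[ℂ] H) (ε : ℝ) : Convex ℝ (nearMaximalMeans B ε) := by
  rintro _ ⟨P, hP, hPε, rfl⟩ _ ⟨Q, hQ, hQε, rfl⟩ a b ha hb hab
  refine ⟨a • P + b • Q, convex_densityOperators hP hQ ha hb hab, ?_, ?_⟩
  · rw [trace_mul_add_smul hP hQ, Complex.add_re, Complex.re_ofReal_mul, Complex.re_ofReal_mul]
    have h1 := mul_le_mul_of_nonneg_left hPε ha
    have h2 := mul_le_mul_of_nonneg_left hQε hb
    have h3 : ‖B‖ ^ 2 - ε = a * (‖B‖ ^ 2 - ε) + b * (‖B‖ ^ 2 - ε) := by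
      rw [← add_mul, hab, one_mul]
    linarith
  · rw [trace_mul_add_smul hP hQ, Complex.real_smul, Complex.real_smul]

/-- A real functional on `ℂ` is `z ↦ Re (w * conj z)`. -/
lemma exists_eq_re_mul_conj (f : ℂ →L[ℝ] ℝ) : ∃ w : ℂ, ∀ z, f z = (w * starRingEnd ℂ z).re := by
  refine ⟨⟨f 1, f Complex.I⟩, fun z => ?_⟩
  have hz : z = z.re • (1 : ℂ) + z.im • Complex.I := by
    simp [Complex.re_add_im]
  conv_lhs => rw [hz, map_add, map_smul, map_smul]
  simp only [smul_eq_mul, Complex.mul_re, Complex.conj_re, Complex.conj_im]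
  ring

/-- If `0` is a best scalar approximation of `B`, then states nearly attaining the norm of `B`
have means approaching `0`. -/
lemma zero_mem_closure_nearMaximalMeans [Nontrivial H] {B : H →L[ℂ] H}
    (hB : ∀ c : ℂ, ‖B‖ ≤ ‖B - c • (1 : H →L[ℂ] H)‖) {ε : ℝ} (hε : 0 < ε) :
    (0 : ℂ) ∈ closure (nearMaximalMeans B ε) := by
  by_contra h0
  obtain ⟨f, u, hu0, hu⟩ := geometric_hahn_banach_point_closed
    (convex_nearMaximalMeans B ε).closure isClosed_closure h0
  rw [map_zero] at hu0
  obtain ⟨w, hw⟩ := exists_eq_re_mul_conj f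
  have hK : 0 < ‖w‖ ^ 2 + 2 * ‖w‖ * ‖B‖ + 2 * u := by positivity
  -- The shift is `s w`. The first bound lets the quadratic term cost at most half the gain `2 s u`
  -- at nearly maximal vectors; the second keeps the total change below the deficit `ε` at all
  -- others.
  obtain ⟨s, hs0, hs1, hs2⟩ : ∃ s : ℝ, 0 < s ∧ s * ‖w‖ ^ 2 ≤ u ∧
      s * (2 * ‖w‖ * ‖B‖ + 2 * u) ≤ ε := by
    refine ⟨min u ε / (‖w‖ ^ 2 + 2 * ‖w‖ * ‖B‖ + 2 * u), by positivity, ?_, ?_⟩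
    · rw [div_mul_eq_mul_div, div_le_iff₀ hK]
      exact mul_le_mul (min_le_left _ _) (by nlinarith [mul_nonneg (norm_nonneg w) (norm_nonneg B)])
        (by positivity) hu0.le
    · rw [div_mul_eq_mul_div, div_le_iff₀ hK]
      exact mul_le_mul (min_le_right _ _) (by nlinarith [sq_nonneg ‖w‖]) (by positivity) hε.le
  have hc : ‖((s : ℂ) * w)‖ ^ 2 = s * (s * ‖w‖ ^ 2) := by
    rw [norm_mul, Complex.norm_real, Real.norm_of_nonneg hs0.le]; ring
  have hunit : ∀ x : H, ‖x‖ = 1 →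
      ‖(B - ((s : ℂ) * w) • (1 : H →L[ℂ] H)) x‖ ^ 2 ≤ ‖B‖ ^ 2 - s * u := by
    intro x hx
    have hBx : ‖B x‖ ≤ ‖B‖ := by simpa [hx] using B.le_opNorm x
    have hBx2 : ‖B x‖ ^ 2 ≤ ‖B‖ ^ 2 := pow_le_pow_left₀ (norm_nonneg _) hBx 2
    rw [norm_sub_smul_one_apply_sq B hx, hc, mul_assoc, Complex.re_ofReal_mul, ← hw]
    have hsw : s * (s * ‖w‖ ^ 2) ≤ s * u := mul_le_mul_of_nonneg_left hs1 hs0.le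
    by_cases hx' : ‖B‖ ^ 2 - ε ≤ ‖B x‖ ^ 2
    · have hmem : ⟪x, B x⟫_ℂ ∈ nearMaximalMeans B ε := by
        refine ⟨rankOne ℂ x x, rankOne_mem_densityOperators hx, ?_, trace_mul_rankOne x B⟩
        rwa [trace_mul_rankOne, inner_star_mul_self_apply, Complex.ofReal_re]
      have hfu := mul_le_mul_of_nonneg_left (hu _ (subset_closure hmem)).le hs0.le
      linarith
    · have hf : -(‖w‖ * ‖B‖) ≤ f ⟪x, B x⟫_ℂ := by
        rw [hw]
        refine neg_le_of_abs_le ((Complex.abs_re_le_norm _).trans ?_)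
        rw [norm_mul, RCLike.norm_conj]
        refine mul_le_mul_of_nonneg_left ((norm_inner_le_norm _ _).trans ?_) (norm_nonneg _)
        rwa [hx, one_mul]
      have hfs := mul_le_mul_of_nonneg_left hf hs0.le
      linarith
  obtain ⟨x₀, hx₀⟩ := exists_norm_eq H zero_le_one
  have hnn : 0 ≤ ‖B‖ ^ 2 - s * u := (sq_nonneg _).trans (hunit x₀ hx₀)
  have hle : ‖B - ((s : ℂ) * w) • (1 : H →L[ℂ] H)‖ ≤ √(‖B‖ ^ 2 - s * u) :=
    opNorm_le_of_unit_norm (𝕜 := ℂ) (Real.sqrt_nonneg _)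
      fun x hx => Real.le_sqrt_of_sq_le (hunit x hx)
  have hsq : ‖B‖ ^ 2 ≤ ‖B‖ ^ 2 - s * u := by
    rw [← Real.sq_sqrt hnn]
    exact pow_le_pow_left₀ (norm_nonneg _) ((hB _).trans hle) 2
  nlinarith [mul_pos hs0 hu0]

lemma exists_best_scalar_approximation [Nontrivial H] (A : H →L[ℂ] H) :
    ∃ c : ℂ, ∀ d : ℂ, ‖A - c • (1 : H →L[ℂ] H)‖ ≤ ‖A - d • (1 : H →L[ℂ] H)‖ := by
  refine Continuous.exists_forall_le (f := fun c : ℂ => ‖A - c • (1 : H →L[ℂ] H)‖)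
    (by fun_prop) ?_
  -- Coercivity: `‖c‖ - ‖A‖ ≤ ‖A - c‖`.
  refine Filter.tendsto_atTop_mono (f := fun c : ℂ => ‖c‖ + -‖A‖) (fun c => ?_)
    (Filter.tendsto_atTop_add_const_right _ _ (tendsto_norm_cocompact_atTop (E := ℂ)))
  have h := norm_sub_norm_le (c • (1 : H →L[ℂ] H)) A
  rw [norm_smul, norm_one, mul_one, norm_sub_rev] at h
  linarith

/-- There are states whose variance is arbitrarily close to the squared distance of `A` to the
scalars. -/
lemma exists_infDist_sq_sub_lt_variance [Nontrivial H] (A : H →L[ℂ] H) {ε : ℝ} (hε : 0 < ε) :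
    ∃ P ∈ densityOperators H,
      Metric.infDist A (Submodule.span ℂ {(1 : H →L[ℂ] H)} : Set (H →L[ℂ] H)) ^ 2 - ε <
        (variance P A).re := by
  obtain ⟨c, hc⟩ := exists_best_scalar_approximation A
  have hB : ∀ d : ℂ, ‖A - c • (1 : H →L[ℂ] H)‖ ≤
      ‖A - c • (1 : H →L[ℂ] H) - d • (1 : H →L[ℂ] H)‖ := fun d => by
    rw [sub_sub, ← add_smul]
    exact hc _
  -- Half of `ε` pays for the second moment, half for the squared mean.
  obtain ⟨_, ⟨P, hP, hPε, rfl⟩, hdist⟩ := Metric.mem_closure_iff.1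
    (zero_mem_closure_nearMaximalMeans hB (half_pos hε)) (√(ε / 2))
    (Real.sqrt_pos.2 (half_pos hε))
  refine ⟨P, hP, ?_⟩
  rw [dist_zero_left, Real.lt_sqrt (norm_nonneg _)] at hdist
  rw [← variance_re_sub_smul_one hP A c, variance_re]
  have := pow_le_pow_left₀ Metric.infDist_nonneg (infDist_span_one_le A c) 2
  linarith

end OperatorVariance

open scoped ComplexOrder in
theorem mainTheorem6 {H : Type u} [NormedAddCommGroup H] [InnerProductSpace ℂ H]
    [CompleteSpace H] [Nontrivial H] (A : H →L[ℂ] H) :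
    (∀ P ∈ OperatorVariance.densityOperators H,
      OperatorVariance.IsTraceClass (CFC.abs A ^ 2 * P) ∧
      OperatorVariance.IsTraceClass (A * P) ∧
      0 ≤ OperatorVariance.variance P A) ∧
    IsLUB {s : ℝ | ∃ P ∈ OperatorVariance.densityOperators H,
        s = Real.sqrt (OperatorVariance.variance P A).re}
      (Metric.infDist A (Submodule.span ℂ {(1 : H →L[ℂ] H)} : Set (H →L[ℂ] H))) := by
  refine ⟨fun P hP => ⟨hP.2.1.mul_left_of_isPositive hP.1 _, hP.2.1.mul_left_of_isPositive hP.1 _,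
    OperatorVariance.variance_nonneg hP A⟩, ?_, ?_⟩
  · rintro _ ⟨P, hP, rfl⟩
    exact OperatorVariance.le_infDist_span_one A fun c =>
      (Real.sqrt_le_left (norm_nonneg _)).2 (OperatorVariance.variance_re_le_norm_sub_sq hP A c)
  · intro r hr
    have hr0 : ∀ P ∈ OperatorVariance.densityOperators H,
        √(OperatorVariance.variance P A).re ≤ r := fun P hP => hr ⟨P, hP, rfl⟩
    -- Any state will do here: it only serves to show `0 ≤ r`.
    obtain ⟨P₀, hP₀, -⟩ := OperatorVariance.exists_infDist_sq_sub_lt_variance A one_pos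
    have hr_nonneg : 0 ≤ r := (Real.sqrt_nonneg _).trans (hr0 P₀ hP₀)
    refine (sq_le_sq₀ Metric.infDist_nonneg hr_nonneg).1 ?_
    refine le_of_forall_pos_lt_add fun ε hε => ?_
    obtain ⟨P, hP, hlt⟩ := OperatorVariance.exists_infDist_sq_sub_lt_variance A hε
    have := (Real.sqrt_le_left hr_nonneg).1 (hr0 P hP)
    linarith
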